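/- Let $m\ge 1$ be an integer and $r>0$. For each integer $N\ge 1$ consider the Gaussian random $SU(m+1)$ polynomial of degree $N$, $$\psi_{\alpha,N}(z)=\sum_{j\in\mathbb{N}^m,\ |j|\le N}\alpha_j\sqrt{\binom{N}{j}}\,z^j,\qquad z\in\mathbb{C}^m,$$ where $|j|=j_1+\dots+j_m$, $z^j=z_1^{j_1}\cdots z_m^{j_m}$, $\binom{N}{j}=\frac{N!}{(N-|j|)!\,j_1!\cdots j_m!}$, and the coefficients $\alpha_j$ are independent identically distributed standard complex Gaussian random variables, i.e. with density $\pi^{-1}e^{-|w|^2}$ with respect to Lebesgue measure on $\mathbb{C}$ (mean $0$, variance $1$). Let $$\mathrm{Hole}_{N,r}=\{\alpha:\ \psi_{\alpha,N}(z)\ne 0\ \text{ for all } z\in B(0,r)\},\qquad B(0,r)=\{z\in\mathbb{C}^m:\ |z|<r\}.$$ Then there exist constants $c_1,c_2>0$ and $N_0\in\mathbb{N}$, depending only on $r$ and $m$, such that for all $N>N_0$ $$e^{-c_2N^{m+1}}\le \mathrm{Prob}(\mathrm{Hole}_{N,r})\le e^{-c_1N^{m+1}}.$$ -/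

import Mathlib

open MeasureTheory ProbabilityTheory

noncomputable section

/-- The standard complex Gaussian law (mean `0`, variance `E|α|² = 1`): the measure on `ℂ` with
density `π⁻¹ exp (-|z|²)` with respect to Lebesgue measure. -/
def stdComplexGaussian : Measure ℂ :=
  (volume : Measure ℂ).withDensity
    fun z => ENNReal.ofReal (Real.pi⁻¹ * Real.exp (-‖z‖ ^ 2))

/-- The multi-indices `j = (j₁, …, j_m)` of natural numbers with `|j| = j₁ + ⋯ + j_m ≤ N`. -/
def multiIdx (m N : ℕ) : Finset (Fin m → ℕ) :=
  (Fintype.piFinset fun _ => Finset.range (N + 1)).filter fun j => ∑ k, j k ≤ N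

theorem mem_multiIdx {m N : ℕ} {j : Fin m → ℕ} : j ∈ multiIdx m N ↔ ∑ k, j k ≤ N := by
  simp only [multiIdx, Finset.mem_filter, Fintype.mem_piFinset, Finset.mem_range,
    and_iff_right_iff_imp]
  intro h k
  exact Nat.lt_succ_of_le
    ((Finset.single_le_sum (fun i _ => Nat.zero_le (j i)) (Finset.mem_univ k)).trans h)

/-- The multinomial coefficient `N! / ((N - |j|)! j₁! ⋯ j_m!)`, for `|j| ≤ N`. -/
def multinomialCoeff {m : ℕ} (N : ℕ) (j : Fin m → ℕ) : ℝ :=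
  (N.factorial : ℝ) / (((N - ∑ k, j k).factorial : ℝ) * ∏ k, ((j k).factorial : ℝ))

/-- The `SU(m+1)` polynomial of degree `N` with coefficient vector `a`, evaluated at `z ∈ ℂᵐ`:
the sum over `|j| ≤ N` of `a_j √(N choose j) z^j`. -/
def suPoly {m N : ℕ} (a : multiIdx m N → ℂ) (z : EuclideanSpace ℂ (Fin m)) : ℂ :=
  ∑ j : multiIdx m N,
    a j * ((Real.sqrt (multinomialCoeff N j.1) : ℝ) : ℂ) * ∏ k, z k ^ j.1 k

/-- The coefficient vectors whose polynomial has no zero in the open Euclidean ball `B(0, r)`. -/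
def hole (m N : ℕ) (r : ℝ) : Set (multiIdx m N → ℂ) :=
  {a | ∀ z ∈ Metric.ball (0 : EuclideanSpace ℂ (Fin m)) r, suPoly a z ≠ 0}

end

/-! Lower bound (`le_pi_hole`): let the constant coefficient lie within `ε = e^{-QN}` of `2` and all
others within `ε` of `0`. There are at most `e^{mN}` monomials, each at most `e^{(m+r)N}` on the
ball, so the polynomial stays within `1` of the constant `2` and has no zero. There are `O(N^m)`
coefficients, and each costs a factor `e^{-O(N)}`.

Upper bound: take `M` comparable to `N`, a primitive `M`-th root of unity `ω`, and the `M^m` points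
`ρ(ω^{a₁}, …, ω^{a_m})` of a polydisc inside the ball. Absence of zeros forces a discrete mean value
inequality (`prod_norm_polydisc_le`): the geometric mean of `|ψ|` over the grid is at most a
constant times `|ψ(0)| = |α₀|`, hence polynomial in `N` off a negligible event.

Such a small product is improbable (`pi_prod_grid_le`). The grid values depend affinely on the
coefficients with indices in the box `[M, 2M)^m`. The matrix is a character matrix
(`one_le_norm_det_character`) times a diagonal of exponentially large weights
(`exp_le_multinomialCoeff_mul`), so its squared determinant is at least `e^{M·M^m}`. Freezing the
other coefficients and bounding the Gaussian density by `1` leaves the inverse of this times the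
volume of a set of vectors with entries `e^{O(N)}` and small product. By `volume_prod_norm_le` that
volume is only `(poly(N) e^{M/4})^{M^m}`, so a bound `e^{-cN^{m+1}}` survives. -/

noncomputable section

/-! ### One-variable Gaussian estimates. -/

open Set in
theorem measure_pi_mono {ι : Type*} [Fintype ι] {X : ι → Type*} [∀ i, MeasurableSpace (X i)]
    {μ ν : ∀ i, Measure (X i)} (h : ∀ i, μ i ≤ ν i) : Measure.pi μ ≤ Measure.pi ν := by
  refine Measure.le_iff.2 fun s hs => ?_
  rw [Measure.pi_def, Measure.pi_def, toMeasure_apply _ _ hs, toMeasure_apply _ _ hs]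
  refine OuterMeasure.le_pi.2 (fun t _ => ?_) s
  refine (OuterMeasure.pi_pi_le _ t).trans ?_
  exact Finset.prod_le_prod' fun i _ => h i (t i)

theorem stdComplexGaussian_le_volume : stdComplexGaussian ≤ (volume : Measure ℂ) := by
  conv_rhs => rw [← withDensity_one (μ := (volume : Measure ℂ))]
  refine withDensity_mono (Filter.Eventually.of_forall fun z => ?_)
  rw [Pi.one_apply, ENNReal.ofReal_le_one]
  have h1 : Real.exp (-‖z‖ ^ 2) ≤ 1 := Real.exp_le_one_iff.2 (by nlinarith [norm_nonneg z])
  have h2 : Real.pi⁻¹ ≤ 1 := inv_le_one_of_one_le₀ (by linarith [Real.pi_gt_three])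
  exact mul_le_one₀ h2 (Real.exp_pos _).le h1

/-- The case `b = 1` gives total mass one; `b = 1/2` gives the tail bound, with half of the exponent
spent on `e^{-T²/2}`. -/
theorem lintegral_gaussian_norm (b : ℝ) (hb : 0 < b) :
    ∫⁻ z : ℂ, ENNReal.ofReal (Real.pi⁻¹ * Real.exp (-b * ‖z‖ ^ 2)) = ENNReal.ofReal b⁻¹ := by
  have h := GaussianFourier.integral_rexp_neg_mul_sq_norm (V := ℂ) hb
  have hpos : 0 < Real.pi := Real.pi_pos
  have h0 : (∫ z : ℂ, Real.exp (-b * ‖z‖ ^ 2)) = Real.pi / b := by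
    rw [h]; simp
  have hint : Integrable fun z : ℂ => Real.exp (-b * ‖z‖ ^ 2) := by
    by_contra hc
    rw [integral_undef hc] at h0
    exact absurd h0 (by positivity)
  rw [← ofReal_integral_eq_lintegral_ofReal (hint.const_mul _)
    (Filter.Eventually.of_forall fun z => by positivity), integral_const_mul, h0]
  congr 1
  field_simp

instance : IsProbabilityMeasure stdComplexGaussian := by
  refine ⟨?_⟩
  rw [stdComplexGaussian, withDensity_apply _ MeasurableSet.univ, Measure.restrict_univ]
  have := lintegral_gaussian_norm 1 one_pos
  simpa using this

theorem stdComplexGaussian_norm_gt_le (T : ℝ) (hT : 0 ≤ T) :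
    stdComplexGaussian {z | T < ‖z‖} ≤ ENNReal.ofReal (2 * Real.exp (-T ^ 2 / 2)) := by
  have hms : MeasurableSet {z : ℂ | T < ‖z‖} := measurableSet_lt measurable_const measurable_norm
  rw [stdComplexGaussian, withDensity_apply _ hms]
  have hpos : 0 < Real.pi := Real.pi_pos
  calc
    _ ≤ ∫⁻ z in {z : ℂ | T < ‖z‖}, ENNReal.ofReal (Real.exp (-T ^ 2 / 2)) *
        ENNReal.ofReal (Real.pi⁻¹ * Real.exp (-(1 / 2 : ℝ) * ‖z‖ ^ 2)) := by
      refine setLIntegral_mono' hms fun z hz => ?_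
      rw [← ENNReal.ofReal_mul (Real.exp_pos _).le]
      refine ENNReal.ofReal_le_ofReal ?_
      have hz' : T < ‖z‖ := hz
      have : Real.exp (-‖z‖ ^ 2) ≤ Real.exp (-T ^ 2 / 2) * Real.exp (-(1 / 2 : ℝ) * ‖z‖ ^ 2) := by
        rw [← Real.exp_add]
        exact Real.exp_le_exp.2 (by nlinarith)
      calc _ ≤ Real.pi⁻¹ * (Real.exp (-T ^ 2 / 2) * Real.exp (-(1 / 2 : ℝ) * ‖z‖ ^ 2)) := by gcongr
        _ = _ := by ring
    _ ≤ ∫⁻ z : ℂ, ENNReal.ofReal (Real.exp (-T ^ 2 / 2)) *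
        ENNReal.ofReal (Real.pi⁻¹ * Real.exp (-(1 / 2 : ℝ) * ‖z‖ ^ 2)) :=
      setLIntegral_le_lintegral _ _
    _ = _ := by
      rw [lintegral_const_mul' _ _ ENNReal.ofReal_ne_top, lintegral_gaussian_norm _ (by norm_num),
        ← ENNReal.ofReal_mul (Real.exp_pos _).le]
      congr 1
      norm_num
      ring

theorem le_stdComplexGaussian_closedBall (c : ℂ) (ε : ℝ) (hε : 0 ≤ ε) :
    ENNReal.ofReal (Real.exp (-(‖c‖ + ε) ^ 2) * ε ^ 2) ≤
      stdComplexGaussian (Metric.closedBall c ε) := by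
  rw [stdComplexGaussian, withDensity_apply _ Metric.isClosed_closedBall.measurableSet]
  have hpos : 0 < Real.pi := Real.pi_pos
  calc
    _ = ∫⁻ z in Metric.closedBall c ε,
        ENNReal.ofReal (Real.pi⁻¹ * Real.exp (-(‖c‖ + ε) ^ 2)) := by
      rw [setLIntegral_const, Complex.volume_closedBall, ← ENNReal.ofReal_pow hε,
        ← ENNReal.ofReal_coe_nnreal, ← ENNReal.ofReal_mul (by positivity),
        ← ENNReal.ofReal_mul (by positivity)]
      congr 1
      simp only [NNReal.coe_real_pi]
      field_simp
    _ ≤ _ := by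
      refine setLIntegral_mono' Metric.isClosed_closedBall.measurableSet fun z hz => ?_
      refine ENNReal.ofReal_le_ofReal ?_
      have h1 : ‖z‖ ≤ ‖c‖ + ε := by
        have := norm_sub_norm_le z c
        rw [Metric.mem_closedBall, dist_eq_norm] at hz
        linarith
      gcongr

/-! ### Small products of affine Gaussian images, and slicing. -/

theorem integral_indicator_rpow_norm (θ R : ℝ) (hθ : 0 < θ) (hR : 0 < R) :
    Integrable (fun z : ℂ => (Set.Iio R).indicator (fun t => t ^ (θ - 2)) ‖z‖) ∧
    ∫ z : ℂ, (Set.Iio R).indicator (fun t => t ^ (θ - 2)) ‖z‖ = 2 * Real.pi * R ^ θ / θ := by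
  have key : Set.EqOn (fun y : ℝ => y ^ (Module.finrank ℝ ℂ - 1) •
      (Set.Iio R).indicator (fun t => t ^ (θ - 2)) y)
      ((Set.Iio R).indicator fun y => y ^ (θ - 1)) (Set.Ioi 0) := by
    intro y hy
    have hy : 0 < y := hy
    simp only [Complex.finrank_real_complex, Set.indicator]
    split_ifs
    · have : θ - 1 = 1 + (θ - 2) := by ring
      rw [this, Real.rpow_add hy]
      simp
    · simp
  have hI : IntervalIntegrable (fun y : ℝ => y ^ (θ - 1)) volume 0 R :=
    intervalIntegral.intervalIntegrable_rpow' (by linarith)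
  constructor
  · rw [integrable_fun_norm_addHaar, integrableOn_congr_fun key measurableSet_Ioi,
      integrableOn_indicator_iff measurableSet_Iio]
    rw [intervalIntegrable_iff_integrableOn_Ioo_of_le hR.le] at hI
    refine hI.mono_set ?_
    rintro x ⟨h1, h2⟩
    exact ⟨h2, h1⟩
  · rw [integral_fun_norm_addHaar, setIntegral_congr_fun measurableSet_Ioi key,
      setIntegral_indicator measurableSet_Iio]
    have : Set.Ioi (0 : ℝ) ∩ Set.Iio R = Set.Ioo 0 R := rfl
    rw [this, ← integral_Ioc_eq_integral_Ioo, ← intervalIntegral.integral_of_le hR.le,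
      integral_rpow (Or.inl (by linarith))]
    simp [Measure.real, Complex.volume_ball, Real.zero_rpow hθ.ne']
    ring

/-- A region of `ℂ^ι` on which the product of the coordinates is small has small volume. -/
theorem volume_prod_norm_le {ι : Type*} [Fintype ι] (θ R Λ : ℝ) (hθ : 0 < θ) (hθ2 : θ < 2)
    (hR : 0 < R) (hΛ : 0 < Λ) :
    volume {ζ : ι → ℂ | (∀ a, ζ a ≠ 0 ∧ ‖ζ a‖ < R) ∧ ∏ a, ‖ζ a‖ ≤ Λ} ≤
      ENNReal.ofReal (Λ ^ (2 - θ) * (2 * Real.pi * R ^ θ / θ) ^ Fintype.card ι) := by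
  obtain ⟨h1, h2⟩ := integral_indicator_rpow_norm θ R hθ hR
  set g : ℂ → ℝ := fun z => (Set.Iio R).indicator (fun t => t ^ (θ - 2)) ‖z‖ with hg
  have hg0 : ∀ z, 0 ≤ g z := fun z =>
    Set.indicator_apply_nonneg fun _ => Real.rpow_nonneg (norm_nonneg z) _
  have hint : Integrable (fun ζ : ι → ℂ => ∏ a, g (ζ a)) := by
    rw [volume_pi]
    exact Integrable.fintype_prod fun _ => h1
  have hval : ∫ ζ : ι → ℂ, ∏ a, g (ζ a) = (2 * Real.pi * R ^ θ / θ) ^ Fintype.card ι := by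
    rw [integral_fintype_prod_volume_eq_pow, h2]
  have hpos : 0 < Λ ^ (θ - 2) := Real.rpow_pos_of_pos hΛ _
  -- Markov's inequality for the function `∏ |ζ_a|^{θ-2}`, which is large where the product is small
  -- since `θ < 2`. Zero coordinates must be excluded because `0 ^ (θ - 2) = 0` for the real power.
  have hsub : {ζ : ι → ℂ | (∀ a, ζ a ≠ 0 ∧ ‖ζ a‖ < R) ∧ ∏ a, ‖ζ a‖ ≤ Λ} ⊆
      {ζ | ENNReal.ofReal (Λ ^ (θ - 2)) ≤ ENNReal.ofReal (∏ a, g (ζ a))} := by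
    rintro ζ ⟨h, hΛ'⟩
    refine ENNReal.ofReal_le_ofReal ?_
    have : ∏ a, g (ζ a) = (∏ a, ‖ζ a‖) ^ (θ - 2) := by
      rw [← Real.finsetProd_rpow _ _ fun a _ => norm_nonneg _]
      refine Finset.prod_congr rfl fun a _ => ?_
      simp only [hg]
      rw [Set.indicator_of_mem (show ‖ζ a‖ ∈ Set.Iio R from (h a).2)]
    rw [this]
    refine Real.rpow_le_rpow_of_nonpos ?_ hΛ' (by linarith)
    exact Finset.prod_pos fun a _ => norm_pos_iff.2 (h a).1
  refine (measure_mono hsub).trans ?_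
  refine (meas_ge_le_lintegral_div hint.aestronglyMeasurable.aemeasurable.ennreal_ofReal
    (by simpa using hpos) ENNReal.ofReal_ne_top).trans ?_
  rw [← ofReal_integral_eq_lintegral_ofReal hint
    (Filter.Eventually.of_forall fun ζ => Finset.prod_nonneg fun a _ => hg0 _), hval,
    ← ENNReal.ofReal_div_of_pos hpos]
  refine ENNReal.ofReal_le_ofReal (le_of_eq ?_)
  rw [show θ - 2 = -(2 - θ) by ring, Real.rpow_neg hΛ.le]
  field_simp

theorem det_restrictScalars_toLin' {ι : Type*} [Fintype ι] [DecidableEq ι] (B : Matrix ι ι ℂ) :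
    LinearMap.det ((Matrix.toLin' B).restrictScalars ℝ) = ‖B.det‖ ^ 2 := by
  rw [LinearMap.det_restrictScalars, Algebra.norm_complex_apply, LinearMap.det_toLin',
    Complex.normSq_eq_norm_sq]

/-- The Gaussian density is at most `1`, so Lebesgue measure dominates. The translation `w` is then
harmless, and the real Jacobian of the complex matrix `B` is `|det B|²`. -/
theorem gaussian_affine_prod_norm_le {ι : Type*} [Fintype ι] [DecidableEq ι] (B : Matrix ι ι ℂ)
    (w : ι → ℂ) (D θ R Λ : ℝ) (hD : 0 < D) (hB : D ≤ ‖B.det‖ ^ 2)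
    (hθ : 0 < θ) (hθ2 : θ < 2) (hR : 0 < R) (hΛ : 0 < Λ) :
    Measure.pi (fun _ : ι => stdComplexGaussian)
      {x | (∀ a, (w + B.mulVec x) a ≠ 0 ∧ ‖(w + B.mulVec x) a‖ < R) ∧
        ∏ a, ‖(w + B.mulVec x) a‖ ≤ Λ} ≤
      ENNReal.ofReal (D⁻¹ * (Λ ^ (2 - θ) * (2 * Real.pi * R ^ θ / θ) ^ Fintype.card ι)) := by
  set V := {ζ : ι → ℂ | (∀ a, ζ a ≠ 0 ∧ ‖ζ a‖ < R) ∧ ∏ a, ‖ζ a‖ ≤ Λ} with hV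
  have h1 : {x | (∀ a, (w + B.mulVec x) a ≠ 0 ∧ ‖(w + B.mulVec x) a‖ < R) ∧
      ∏ a, ‖(w + B.mulVec x) a‖ ≤ Λ} =
      ((Matrix.toLin' B).restrictScalars ℝ) ⁻¹' ((fun ζ => w + ζ) ⁻¹' V) := by
    ext x; simp [hV]
  have hdet := det_restrictScalars_toLin' B
  have hd0 : 0 < ‖B.det‖ ^ 2 := hD.trans_le hB
  refine (Measure.le_iff'.1 (measure_pi_mono fun _ => stdComplexGaussian_le_volume) _).trans ?_
  rw [h1, ← volume_pi, Measure.addHaar_preimage_linearMap _ (by rw [hdet]; exact hd0.ne'),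
    measure_preimage_add, hdet, ENNReal.ofReal_mul (by positivity)]
  refine mul_le_mul' (ENNReal.ofReal_le_ofReal ?_) (volume_prod_norm_le θ R Λ hθ hθ2 hR hΛ)
  rw [abs_of_pos (by positivity)]
  exact inv_anti₀ hD hB

/-- To bound a product measure, it suffices to bound it along all slices in the coordinates
in the range of an injection. -/
theorem measure_pi_le_of_forall_slice {ι J X : Type*} [Fintype ι] [Fintype J]
    [MeasurableSpace X] (μ : Measure X) [IsProbabilityMeasure μ] (e : ι → J)
    (he : Function.Injective e) (S : Set (J → X)) (hS : MeasurableSet S) (c : ENNReal)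
    (h : ∀ y : J → X, Measure.pi (fun _ : ι => μ)
      {x | ∃ u ∈ S, (∀ k, u (e k) = x k) ∧ ∀ j ∉ Set.range e, u j = y j} ≤ c) :
    Measure.pi (fun _ : J => μ) S ≤ c := by
  classical
  let E : ι ⊕ {j // j ∉ Set.range e} ≃ J :=
    (Equiv.sumCongr (Equiv.ofInjective e he) (Equiv.refl _)).trans
      (Equiv.Set.sumCompl (Set.range e))
  have m1 := measurePreserving_piCongrLeft (fun _ : J => μ) E
  have m2 := measurePreserving_sumPiEquivProdPi_symm (fun _ : ι ⊕ {j // j ∉ Set.range e} => μ)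
  have m3 := m1.comp m2
  obtain ⟨x0⟩ : Nonempty X := by
    by_contra hc
    rw [not_nonempty_iff] at hc
    have := measure_univ (μ := μ)
    simp [Set.eq_empty_of_isEmpty] at this
  rw [← m3.measure_preimage hS.nullMeasurableSet,
    ← Measure.prod_swap, Measure.map_apply measurable_swap (m3.measurable hS),
    Measure.prod_apply (measurable_swap (m3.measurable hS))]
  calc _ ≤ ∫⁻ _, c ∂(Measure.pi fun _ : {j // j ∉ Set.range e} => μ) := by
        refine lintegral_mono fun y => ?_
        -- Only coordinates off the range of `e` are constrained by `y`; `x0` is a filler elsewhere.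
        refine (measure_mono ?_).trans (h fun j => if hj : j ∉ Set.range e then y ⟨j, hj⟩ else x0)
        intro x hx
        refine ⟨_, hx, fun k => ?_, fun j hj => ?_⟩
        · have := Equiv.piCongrLeft_apply_apply (fun _ : J => X) E
            (Sum.elim x y) (Sum.inl k)
          exact this
        · have := Equiv.piCongrLeft_apply_apply (fun _ : J => X) E
            (Sum.elim x y) (Sum.inr ⟨j, hj⟩)
          rw [dif_pos hj]
          exact this
    _ = c := by simp

/-! ### Discrete mean value inequalities and the character matrix. -/

theorem prod_norm_sub_primitiveRoot {M : ℕ} (hM : 0 < M) {ω : ℂ} (hω : IsPrimitiveRoot ω M)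
    (ρ ζ : ℂ) : ∏ a : Fin M, ‖ρ * ω ^ (a : ℕ) - ζ‖ = ‖ζ ^ M - ρ ^ M‖ := by
  have : NeZero M := ⟨hM.ne'⟩
  rw [hω.pow_sub_pow_eq_prod_sub_mul _ _ hM, norm_prod]
  rw [← Fin.prod_univ_eq_prod_range (fun a => ‖ρ * ω ^ a - ζ‖) M |>.symm]
  refine Finset.prod_bij (fun a _ => ω ^ a) ?_ ?_ ?_ ?_
  · intro a _
    rw [Polynomial.mem_nthRootsFinset hM, ← pow_mul, mul_comm, pow_mul, hω.pow_eq_one, one_pow]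
  · intro a ha b hb h
    exact hω.pow_inj (Finset.mem_range.1 ha) (Finset.mem_range.1 hb) h
  · intro x hx
    rw [Polynomial.mem_nthRootsFinset hM] at hx
    obtain ⟨i, hi, h⟩ := hω.eq_pow_of_pow_eq_one hx
    exact ⟨i, Finset.mem_range.2 hi, h⟩
  · intro a _
    rw [norm_sub_rev, mul_comm]

/-- For a polynomial without zeros in a closed disc, the product of its moduli at equidistributed
points on the boundary circle is controlled by its modulus at the centre. -/
theorem prod_norm_eval_le {M N : ℕ} (hM : 0 < M) {ω : ℂ} (hω : IsPrimitiveRoot ω M)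
    {ρ : ℝ} (hρ : 0 ≤ ρ) (g : Polynomial ℂ) (hdeg : g.natDegree ≤ N)
    (hg : ∀ w : ℂ, ‖w‖ ≤ ρ → g.eval w ≠ 0) :
    ∏ a : Fin M, ‖g.eval (ρ * ω ^ (a : ℕ))‖ ≤ ‖g.eval 0‖ ^ M * 2 ^ N := by
  have hsplit := IsAlgClosed.splits g
  -- Root by root: since `|ζ| ≥ ρ`, a root contributes `|ζ^M - ρ^M| ≤ 2|ζ|^M`, so each costs a
  -- factor `2` against its contribution at the centre.
  have key : ∀ s : Multiset ℂ, (∀ ζ ∈ s, ρ ≤ ‖ζ‖) →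
      ∏ a : Fin M, ‖(s.map fun ζ => (ρ * ω ^ (a : ℕ) - ζ : ℂ)).prod‖ ≤
        ‖(s.map fun ζ => (0 - ζ : ℂ)).prod‖ ^ M * 2 ^ s.card := by
    intro s
    induction s using Multiset.induction_on with
    | empty => simp
    | cons ζ s ih =>
      intro h
      have ih' := ih fun x hx => h x (Multiset.mem_cons_of_mem hx)
      simp only [Multiset.map_cons, Multiset.prod_cons, norm_mul, Multiset.card_cons,
        Finset.prod_mul_distrib]
      rw [prod_norm_sub_primitiveRoot hM hω]
      have h1 : ‖ζ ^ M - (ρ : ℂ) ^ M‖ ≤ 2 * ‖ζ‖ ^ M := by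
        refine (norm_sub_le _ _).trans ?_
        rw [norm_pow, norm_pow, Complex.norm_real, Real.norm_of_nonneg hρ, two_mul]
        gcongr
        exact h ζ (Multiset.mem_cons_self ζ s)
      calc _ ≤ (2 * ‖ζ‖ ^ M) * (‖(s.map fun ζ => (0 - ζ : ℂ)).prod‖ ^ M * 2 ^ s.card) := by
            gcongr
        _ = _ := by rw [zero_sub, norm_neg]; ring
  have hg0 : g ≠ 0 := by
    rintro rfl
    exact hg 0 (by simpa using hρ) (by simp)
  have heval : ∀ x : ℂ, g.eval x = g.leadingCoeff * (g.roots.map fun ζ => x - ζ).prod :=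
    fun x => hsplit.eval_eq_prod_roots x
  have hk := key g.roots fun ζ hζ => by
    by_contra hlt
    exact hg ζ (not_le.1 hlt).le ((Polynomial.mem_roots hg0).1 hζ)
  simp only [heval, norm_mul, Finset.prod_mul_distrib, Finset.prod_const, Finset.card_univ,
    Fintype.card_fin, mul_pow]
  rw [mul_assoc]
  gcongr
  refine hk.trans ?_
  gcongr
  · norm_num
  · exact (Polynomial.card_roots' g).trans hdeg

/-- The iterated version of `prod_norm_eval_le` on a polydisc. -/
theorem prod_norm_polydisc_le {M N : ℕ} (hM : 0 < M) {ω : ℂ} (hω : IsPrimitiveRoot ω M)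
    {ρ C : ℝ} (hρ : 0 ≤ ρ) (hC : 0 ≤ C) (hNC : 2 ^ N ≤ C ^ M) (m : ℕ) :
    ∀ f : (Fin m → ℂ) → ℂ,
      (∀ i z, ∃ g : Polynomial ℂ, g.natDegree ≤ N ∧ ∀ w, f (Function.update z i w) = g.eval w) →
      (∀ z, (∀ i, ‖z i‖ ≤ ρ) → f z ≠ 0) →
      ∏ a : Fin m → Fin M, ‖f fun i => ρ * ω ^ (a i : ℕ)‖ ≤ (C ^ m * ‖f 0‖) ^ (M ^ m) := by
  induction m with
  | zero =>
    intro f _ _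
    simp only [Fintype.prod_unique, pow_zero, one_mul, pow_one]
    exact le_of_eq (congrArg (fun z => ‖f z‖) (Subsingleton.elim _ _))
  | succ m ih =>
    intro f hf hz
    have hωn : ‖ω‖ = 1 := hω.norm'_eq_one hM.ne'
    have hpt : ∀ a : ℕ, ‖(ρ * ω ^ a : ℂ)‖ ≤ ρ := fun a => by
      rw [norm_mul, norm_pow, hωn, one_pow, mul_one, Complex.norm_real, Real.norm_of_nonneg hρ]
    have h1 : ∀ a₀ : Fin M, ∏ a : Fin m → Fin M,
        ‖f (Fin.cons (ρ * ω ^ (a₀ : ℕ)) fun i => ρ * ω ^ (a i : ℕ))‖ ≤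
        (C ^ m * ‖f (Fin.cons (ρ * ω ^ (a₀ : ℕ)) 0)‖) ^ (M ^ m) := by
      intro a₀
      refine ih (fun z => f (Fin.cons (ρ * ω ^ (a₀ : ℕ)) z)) (fun i z => ?_) (fun z h => ?_)
      · obtain ⟨g, hg, hw⟩ := hf i.succ (Fin.cons (ρ * ω ^ (a₀ : ℕ)) z)
        refine ⟨g, hg, fun w => ?_⟩
        rw [Fin.cons_update, hw]
      · refine hz _ fun i => ?_
        refine Fin.cases ?_ (fun i => ?_) i
        · simpa using hpt a₀
        · simpa using h i
    -- Once the last `m` coordinates have been moved to `0`, the one-variable bound applies along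
    -- the first axis.
    have h2 : ∏ a₀ : Fin M, ‖f (Fin.cons (ρ * ω ^ (a₀ : ℕ)) 0)‖ ≤ (C * ‖f 0‖) ^ M := by
      obtain ⟨g, hg, hw⟩ := hf 0 0
      have hcons : ∀ w : ℂ, f (Fin.cons w 0) = g.eval w := fun w => by
        rw [← hw w]
        congr 1
        ext i
        refine Fin.cases ?_ (fun i => ?_) i <;> simp
      have h0 : f 0 = g.eval 0 := by
        rw [← hw 0]
        simp
      simp only [hcons, h0]
      refine (prod_norm_eval_le hM hω hρ g hg fun w hwρ => ?_).trans ?_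
      · rw [← hcons]
        refine hz _ fun i => ?_
        refine Fin.cases ?_ (fun i => ?_) i
        · simpa using hwρ
        · simpa using hρ
      · rw [mul_pow, mul_comm]
        gcongr
    calc _ = ∏ a₀ : Fin M, ∏ a : Fin m → Fin M,
          ‖f (Fin.cons (ρ * ω ^ (a₀ : ℕ)) fun i => ρ * ω ^ (a i : ℕ))‖ := by
          rw [← Fintype.prod_prod_type']
          refine Fintype.prod_equiv (Fin.consEquiv fun _ => Fin M).symm _ _ fun a => ?_
          congr 2
          ext i
          refine Fin.cases ?_ (fun i => ?_) i <;> simp [Fin.consEquiv, Fin.tail]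
      _ ≤ ∏ a₀ : Fin M, (C ^ m * ‖f (Fin.cons (ρ * ω ^ (a₀ : ℕ)) 0)‖) ^ (M ^ m) := by
          exact Finset.prod_le_prod (fun _ _ => by positivity) fun a _ => h1 a
      _ = ((C ^ m) ^ M * ∏ a₀ : Fin M, ‖f (Fin.cons (ρ * ω ^ (a₀ : ℕ)) 0)‖) ^ (M ^ m) := by
          rw [Finset.prod_pow, Finset.prod_mul_distrib]
          simp
      _ ≤ ((C ^ m) ^ M * (C * ‖f 0‖) ^ M) ^ (M ^ m) := by gcongr
      _ = _ := by
          rw [← mul_pow, ← pow_mul, ← pow_succ' M m, pow_succ C m, mul_assoc]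

/-- Orthogonality of the characters of `(ℤ/M)^m`. -/
theorem one_le_norm_det_character {m M : ℕ} (hM : 0 < M) {ω : ℂ} (hω : IsPrimitiveRoot ω M)
    (n : ℕ) :
    1 ≤ ‖(Matrix.of fun a k : Fin m → Fin M => ∏ i, (ω ^ (a i : ℕ)) ^ (n + (k i : ℕ))).det‖ := by
  set F : Matrix (Fin m → Fin M) (Fin m → Fin M) ℂ :=
    Matrix.of fun a k => ∏ i, (ω ^ (a i : ℕ)) ^ (n + (k i : ℕ)) with hF
  set G : Matrix (Fin m → Fin M) (Fin m → Fin M) ℂ :=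
    Matrix.of fun k b => ∏ i, ((ω⁻¹) ^ (b i : ℕ)) ^ (n + (k i : ℕ)) with hG
  have hωn : ‖ω‖ = 1 := hω.norm'_eq_one hM.ne'
  have hω0 : ω ≠ 0 := hω.ne_zero hM.ne'
  -- `G` is the conjugate transpose of `F`, so this identity gives `|det F|² = (M^m)^{M^m} ≥ 1`. Off
  -- the diagonal some coordinate yields a full geometric sum of a nontrivial `M`-th root of unity.
  have hFG : F * G = ((M : ℂ) ^ m) • (1 : Matrix (Fin m → Fin M) (Fin m → Fin M) ℂ) := by
    ext a b
    have h1 : (F * G) a b =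
        ∏ i, ∑ k : Fin M, (ω ^ (a i : ℕ) * (ω⁻¹) ^ (b i : ℕ)) ^ (n + (k : ℕ)) := by
      rw [Matrix.mul_apply, Fintype.prod_sum]
      refine Finset.sum_congr rfl fun k _ => ?_
      rw [hF, hG, Matrix.of_apply, Matrix.of_apply, ← Finset.prod_mul_distrib]
      exact Finset.prod_congr rfl fun i _ => (mul_pow _ _ _).symm
    rw [h1, Matrix.smul_apply, Matrix.one_apply]
    split_ifs with hab
    · subst hab
      simp [hω0]
    · obtain ⟨i, hi⟩ := Function.ne_iff.1 hab
      rw [smul_zero]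
      refine Finset.prod_eq_zero (Finset.mem_univ i) ?_
      set x := ω ^ (a i : ℕ) * (ω⁻¹) ^ (b i : ℕ) with hx
      have hx1 : x ≠ 1 := by
        intro h
        rw [hx, inv_pow, mul_inv_eq_one₀ (pow_ne_zero _ hω0)] at h
        exact hi (Fin.ext (hω.pow_inj (a i).2 (b i).2 h))
      have hxM : x ^ M = 1 := by
        rw [hx, mul_pow, ← pow_mul, ← pow_mul, mul_comm, pow_mul', pow_mul' ω, inv_pow,
          hω.pow_eq_one]
        simp
      simp only [pow_add, ← Finset.mul_sum]
      rw [Fin.sum_univ_eq_sum_range (fun k => x ^ k) M, geom_sum_eq hx1, hxM]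
      simp
  have hnF : ‖G.det‖ = ‖F.det‖ := by
    have : G = (F.map (starRingEnd ℂ)).transpose := by
      ext k b
      simp only [hF, hG, Matrix.of_apply, Matrix.transpose_apply, Matrix.map_apply, map_prod,
        map_pow]
      have : ω⁻¹ = (starRingEnd ℂ) ω := Complex.inv_eq_conj hωn
      rw [this]
    rw [this, Matrix.det_transpose, ← RingHom.mapMatrix_apply, ← RingHom.map_det]
    simp
  have hdet := congrArg (fun A => ‖Matrix.det A‖) hFG
  simp only [Matrix.det_mul, norm_mul, hnF, Matrix.det_smul, Matrix.det_one, mul_one, norm_pow,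
    Complex.norm_natCast] at hdet
  have hM1 : (1 : ℝ) ≤ M := by exact_mod_cast hM
  have : (1 : ℝ) ≤ ‖F.det‖ * ‖F.det‖ := by
    rw [hdet]
    exact one_le_pow₀ (one_le_pow₀ hM1)
  nlinarith [norm_nonneg F.det]

/-! ### Sizes of the coefficients and of the polynomial. -/

theorem multinomialCoeff_nonneg {m : ℕ} (N : ℕ) (j : Fin m → ℕ) : 0 ≤ multinomialCoeff N j := by
  unfold multinomialCoeff
  positivity

theorem multinomialCoeff_eq {m N : ℕ} {j : Fin m → ℕ} (hj : ∑ k, j k ≤ N) :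
    multinomialCoeff N j = (N.descFactorial (∑ k, j k) : ℝ) / ∏ k, ((j k).factorial : ℝ) := by
  unfold multinomialCoeff
  have h := Nat.factorial_mul_descFactorial hj
  have h' : ((N - ∑ k, j k).factorial : ℝ) * (N.descFactorial (∑ k, j k) : ℝ) = N.factorial := by
    exact_mod_cast h
  have h0 : ((N - ∑ k, j k).factorial : ℝ) ≠ 0 := by positivity
  rw [← h', mul_div_mul_left _ _ h0]

theorem multinomialCoeff_le_exp {m N : ℕ} {j : Fin m → ℕ} (hj : ∑ k, j k ≤ N) :
    multinomialCoeff N j ≤ Real.exp (m * N) := by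
  rw [multinomialCoeff_eq hj]
  have h1 : (N.descFactorial (∑ k, j k) : ℝ) ≤ ∏ k, (N : ℝ) ^ j k := by
    rw [Finset.prod_pow_eq_pow_sum]
    exact_mod_cast Nat.descFactorial_le_pow N _
  calc _ ≤ (∏ k, (N : ℝ) ^ j k) / ∏ k, ((j k).factorial : ℝ) := by gcongr
    _ = ∏ k, ((N : ℝ) ^ j k / ((j k).factorial : ℝ)) := (Finset.prod_div_distrib ..).symm
    _ ≤ ∏ _k : Fin m, Real.exp N :=
      Finset.prod_le_prod (fun _ _ => by positivity) fun k _ =>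
        Real.pow_div_factorial_le_exp _ (Nat.cast_nonneg N) (j k)
    _ = _ := by rw [Finset.prod_const, Finset.card_univ, Fintype.card_fin, ← Real.exp_nat_mul]

/-- Weighted multinomial coefficients are exponentially large on a suitable box of indices. -/
theorem exp_le_multinomialCoeff_mul {m N M q : ℕ} {ρ : ℝ} (hm : 1 ≤ m) (hq : 4 * m ≤ q)
    (hqρ : 12 ≤ q * ρ ^ 2) (hM : 0 < M) (hqM : q * M ≤ N) {j : Fin m → ℕ}
    (h1 : ∀ k, M ≤ j k) (h2 : ∀ k, j k ≤ 2 * M) :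
    Real.exp M ≤ multinomialCoeff N j * (ρ ^ (∑ k, j k)) ^ 2 := by
  have hsum : ∑ k, j k ≤ 2 * m * M := by
    calc ∑ k, j k ≤ ∑ _k : Fin m, 2 * M := Finset.sum_le_sum fun k _ => h2 k
      _ = 2 * m * M := by simp; ring
  have hsumM : M ≤ ∑ k, j k :=
    (h1 ⟨0, hm⟩).trans (Finset.single_le_sum (fun i _ => Nat.zero_le (j i)) (Finset.mem_univ _))
  have hN : 2 * (2 * m * M) ≤ N := by nlinarith
  rw [multinomialCoeff_eq (by omega)]
  have hMR : (0 : ℝ) < M := by exact_mod_cast hM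
  -- As `q ≥ 4m`, the degree is at most `N/2`, so every factor of the descending factorial is at
  -- least `qM/2`.
  have ha : ((q * M : ℝ) / 2) ^ (∑ k, j k) ≤ (N.descFactorial (∑ k, j k) : ℝ) := by
    have hb : (N + 1 - ∑ k, j k : ℕ) ^ (∑ k, j k) ≤ N.descFactorial (∑ k, j k) :=
      Nat.pow_sub_le_descFactorial N _
    have hc : (q * M : ℝ) / 2 ≤ ((N + 1 - ∑ k, j k : ℕ) : ℝ) := by
      rw [div_le_iff₀ two_pos]
      have : q * M ≤ (N + 1 - ∑ k, j k : ℕ) * 2 := by omega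
      exact_mod_cast this
    calc _ ≤ ((N + 1 - ∑ k, j k : ℕ) : ℝ) ^ (∑ k, j k) := by gcongr
      _ ≤ _ := by exact_mod_cast hb
  have hd : ∏ k, ((j k).factorial : ℝ) ≤ (2 * M : ℝ) ^ (∑ k, j k) := by
    rw [← Finset.prod_pow_eq_pow_sum]
    refine Finset.prod_le_prod (fun _ _ => by positivity) fun k _ => ?_
    have h3 : (j k).factorial ≤ (2 * M) ^ j k :=
      (Nat.factorial_le_pow (j k)).trans (Nat.pow_le_pow_left (h2 k) _)
    exact_mod_cast h3
  calc Real.exp M = Real.exp 1 ^ M := by rw [← Real.exp_nat_mul, mul_one]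
    _ ≤ 3 ^ M := by
      gcongr
      exact Real.exp_one_lt_three.le
    _ ≤ 3 ^ (∑ k, j k) := pow_le_pow_right₀ (by norm_num) hsumM
    _ ≤ (q * ρ ^ 2 / 4) ^ (∑ k, j k) := by
      gcongr
      linarith
    _ = ((q * M : ℝ) / 2) ^ (∑ k, j k) / (2 * M : ℝ) ^ (∑ k, j k) * (ρ ^ (∑ k, j k)) ^ 2 := by
      rw [← pow_mul, mul_comm _ 2, pow_mul, ← div_pow, ← mul_pow]
      congr 1
      field_simp
      ring
    _ ≤ _ := by gcongr

theorem card_multiIdx_le (m N : ℕ) : (multiIdx m N).card ≤ (N + 1) ^ m := by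
  unfold multiIdx
  refine (Finset.card_filter_le _ _).trans ?_
  rw [Fintype.card_piFinset]
  simp

theorem suPoly_update {m N : ℕ} (a : multiIdx m N → ℂ) (i : Fin m) (z : Fin m → ℂ) :
    ∃ g : Polynomial ℂ, g.natDegree ≤ N ∧
      ∀ w, suPoly a (WithLp.toLp 2 (Function.update z i w)) = g.eval w := by
  refine ⟨∑ j : multiIdx m N, Polynomial.C (a j * ((Real.sqrt (multinomialCoeff N j.1) : ℝ) : ℂ) *
    ∏ k ∈ Finset.univ.erase i, z k ^ j.1 k) * Polynomial.X ^ j.1 i, ?_, fun w => ?_⟩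
  · refine Polynomial.natDegree_sum_le_of_forall_le _ _ fun j _ => ?_
    refine (Polynomial.natDegree_C_mul_X_pow_le _ _).trans ?_
    exact (Finset.single_le_sum (fun i _ => Nat.zero_le (j.1 i)) (Finset.mem_univ i)).trans
      (mem_multiIdx.1 j.2)
  · rw [suPoly, Polynomial.eval_finsetSum]
    refine Finset.sum_congr rfl fun j _ => ?_
    rw [← Finset.mul_prod_erase _ _ (Finset.mem_univ i)]
    simp only [Function.update_self, Polynomial.eval_mul, Polynomial.eval_C, Polynomial.eval_pow,
      Polynomial.eval_X]
    rw [Finset.prod_congr rfl (g := fun k => z k ^ j.1 k) fun k hk => by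
      rw [Function.update_of_ne (Finset.ne_of_mem_erase hk)]]
    ring

theorem zero_mem_multiIdx (m N : ℕ) : (0 : Fin m → ℕ) ∈ multiIdx m N := by
  simp [mem_multiIdx]

theorem suPoly_zero {m N : ℕ} (a : multiIdx m N → ℂ) :
    suPoly a 0 = a ⟨0, zero_mem_multiIdx m N⟩ := by
  rw [suPoly, Finset.sum_eq_single ⟨0, zero_mem_multiIdx m N⟩]
  · simp [multinomialCoeff, Nat.factorial_ne_zero]
  · intro j _ hj
    have : ∃ i, j.1 i ≠ 0 := by
      by_contra hc
      push Not at hc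
      exact hj (Subtype.ext (funext hc))
    obtain ⟨i, hi⟩ := this
    rw [Finset.prod_eq_zero (Finset.mem_univ i) (by simp [hi]), mul_zero]
  · simp

theorem norm_monomial_le {m N : ℕ} {r : ℝ} (hr : 0 ≤ r) (j : multiIdx m N)
    (z : EuclideanSpace ℂ (Fin m)) (hz : ∀ k, ‖z k‖ ≤ r) :
    ‖((Real.sqrt (multinomialCoeff N j.1) : ℝ) : ℂ) * ∏ k, z k ^ j.1 k‖ ≤
      Real.exp ((m + r) * N) := by
  have hj := mem_multiIdx.1 j.2
  rw [norm_mul, Complex.norm_real, Real.norm_of_nonneg (Real.sqrt_nonneg _), norm_prod, add_mul,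
    Real.exp_add]
  refine mul_le_mul ?_ ?_ (by positivity) (by positivity)
  · rw [Real.sqrt_le_left (by positivity)]
    have h1 : (1 : ℝ) ≤ Real.exp (m * N) := Real.one_le_exp (by positivity)
    nlinarith [multinomialCoeff_le_exp hj]
  -- Base `1 + r` rather than `r`, so that raising the exponent to `N` only increases the power.
  · calc _ ≤ ∏ k, (1 + r) ^ j.1 k := by
          refine Finset.prod_le_prod (fun _ _ => by positivity) fun k _ => ?_
          rw [norm_pow]
          gcongr
          linarith [hz k]
      _ = (1 + r) ^ ∑ k, j.1 k := Finset.prod_pow_eq_pow_sum ..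
      _ ≤ (1 + r) ^ N := pow_le_pow_right₀ (by linarith) hj
      _ ≤ Real.exp r ^ N := by
          gcongr
          linarith [Real.add_one_le_exp r]
      _ = _ := by rw [← Real.exp_nat_mul, mul_comm]

theorem card_multiIdx_le_exp (m N : ℕ) : ((multiIdx m N).card : ℝ) ≤ Real.exp (m * N) := by
  calc ((multiIdx m N).card : ℝ) ≤ ((N : ℝ) + 1) ^ m := by exact_mod_cast card_multiIdx_le m N
    _ ≤ Real.exp N ^ m := by
      gcongr
      exact Real.add_one_le_exp _
    _ = _ := by rw [← Real.exp_nat_mul]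

theorem norm_sum_monomial_le {m N : ℕ} {r T : ℝ} (hr : 0 ≤ r) (hT : 0 ≤ T)
    (s : Finset (multiIdx m N)) (a : multiIdx m N → ℂ) (ha : ∀ j ∈ s, ‖a j‖ ≤ T)
    (z : EuclideanSpace ℂ (Fin m)) (hz : ∀ k, ‖z k‖ ≤ r) :
    ‖∑ j ∈ s, a j * ((Real.sqrt (multinomialCoeff N j.1) : ℝ) : ℂ) * ∏ k, z k ^ j.1 k‖ ≤
      T * Real.exp ((2 * m + r) * N) := by
  calc _ ≤ ∑ _j ∈ s, T * Real.exp ((m + r) * N) := by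
        refine norm_sum_le_of_le _ fun j hj => ?_
        rw [mul_assoc, norm_mul]
        exact mul_le_mul (ha j hj) (norm_monomial_le hr j z hz) (norm_nonneg _) hT
    _ ≤ ∑ _j : multiIdx m N, T * Real.exp ((m + r) * N) :=
        Finset.sum_le_sum_of_subset_of_nonneg (Finset.subset_univ s) fun _ _ _ => by positivity
    _ = T * ((multiIdx m N).card * Real.exp ((m + r) * N)) := by
        simp
        ring
    _ ≤ T * (Real.exp (m * N) * Real.exp ((m + r) * N)) := by
        gcongr
        exact card_multiIdx_le_exp m N
    _ = _ := by
        rw [← Real.exp_add]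
        ring_nf

/-! ### The lower bound. -/

theorem le_pi_hole (m N : ℕ) (r : ℝ) (hr : 0 < r) (hN : 1 ≤ N) :
    ∃ S : Set (multiIdx m N → ℂ), MeasurableSet S ∧ S ⊆ hole m N r ∧
      ENNReal.ofReal (Real.exp (-(2 ^ m * (9 + 2 * (2 * m + r + 1))) * (N : ℝ) ^ (m + 1))) ≤
        Measure.pi (fun _ => stdComplexGaussian) S := by
  classical
  set Q : ℝ := 2 * m + r + 1 with hQ
  have hQ0 : 0 < Q := by positivity
  have hNR : (1 : ℝ) ≤ N := by exact_mod_cast hN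
  -- With `Q = 2m + r + 1`, the perturbation `ε e^{(2m+r)N}` equals `e^{-N}`, which is below `2`.
  set ε : ℝ := Real.exp (-(Q * N)) with hε
  have hε0 : 0 < ε := Real.exp_pos _
  have hε1 : ε ≤ 1 := Real.exp_le_one_iff.2 (by nlinarith)
  set j₀ : multiIdx m N := ⟨0, zero_mem_multiIdx m N⟩ with hj₀
  set c : multiIdx m N → ℂ := fun j => if j = j₀ then 2 else 0 with hc
  refine ⟨Set.univ.pi fun j => Metric.closedBall (c j) ε,
    MeasurableSet.univ_pi fun j => Metric.isClosed_closedBall.measurableSet, ?_, ?_⟩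
  · intro a ha z hz h0
    have hzk : ∀ k, ‖z k‖ ≤ r := fun k =>
      (PiLp.norm_apply_le z k).trans (mem_ball_zero_iff.1 hz).le
    have ha' : ∀ j, ‖a j - c j‖ ≤ ε := fun j => by
      simpa [dist_eq_norm] using ha j (Set.mem_univ j)
    have hsum := norm_sum_monomial_le hr.le hε0.le Finset.univ (fun j => a j - c j)
      (fun j _ => ha' j) z hzk
    have hsplit : ∑ j, (a j - c j) * ((Real.sqrt (multinomialCoeff N j.1) : ℝ) : ℂ) *
        ∏ k, z k ^ j.1 k = suPoly a z - 2 := by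
      simp only [sub_mul, Finset.sum_sub_distrib]
      congr 1
      rw [Finset.sum_eq_single j₀]
      · simp [hc, hj₀, multinomialCoeff, Nat.factorial_ne_zero]
      · intro j _ hj
        simp [hc, hj]
      · simp
    rw [hsplit, h0, hε, ← Real.exp_add] at hsum
    have : Real.exp (-(Q * N) + (2 * m + r) * N) ≤ 1 := Real.exp_le_one_iff.2 (by
      rw [hQ]; nlinarith)
    norm_num at hsum
    linarith
  · rw [Measure.pi_pi]
    -- Centres have modulus at most `2` and `ε ≤ 1`, whence `9 = (2 + 1)²`.
    have hj : ∀ j, ENNReal.ofReal (Real.exp (-9) * ε ^ 2) ≤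
        stdComplexGaussian (Metric.closedBall (c j) ε) := fun j => by
      refine le_trans (ENNReal.ofReal_le_ofReal ?_) (le_stdComplexGaussian_closedBall (c j) ε hε0.le)
      have hcj : ‖c j‖ ≤ 2 := by
        simp only [hc]
        split_ifs <;> simp
      gcongr
      have : 0 ≤ ‖c j‖ := norm_nonneg _
      nlinarith
    calc _ ≤ ∏ _j : multiIdx m N, ENNReal.ofReal (Real.exp (-9) * ε ^ 2) := by
          rw [Finset.prod_const, ← ENNReal.ofReal_pow (by positivity)]
          refine ENNReal.ofReal_le_ofReal ?_
          rw [hε, ← Real.exp_nat_mul, ← Real.exp_add, ← Real.exp_nat_mul, Real.exp_le_exp,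
            Finset.card_univ, Fintype.card_coe]
          have hcard : ((multiIdx m N).card : ℝ) ≤ 2 ^ m * (N : ℝ) ^ m := by
            calc ((multiIdx m N).card : ℝ) ≤ ((N : ℝ) + 1) ^ m := by
                  exact_mod_cast card_multiIdx_le m N
              _ ≤ (2 * N) ^ m := by
                  gcongr
                  linarith
              _ = _ := mul_pow _ _ _
          have h1 : ((multiIdx m N).card : ℝ) * (9 + 2 * (Q * N)) ≤
              (2 ^ m * (N : ℝ) ^ m) * ((9 + 2 * Q) * N) := by
            refine mul_le_mul hcard ?_ (by positivity) (by positivity)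
            nlinarith
          have h2 : (2 ^ m * (N : ℝ) ^ m) * ((9 + 2 * Q) * N) =
              2 ^ m * (9 + 2 * Q) * (N : ℝ) ^ (m + 1) := by ring
          push_cast
          linarith
      _ ≤ _ := Finset.prod_le_prod' fun j _ => hj j

/-! ### The upper bound. -/

theorem continuous_suPoly {m N : ℕ} (z : EuclideanSpace ℂ (Fin m)) :
    Continuous fun u : multiIdx m N → ℂ => suPoly u z := by
  unfold suPoly
  fun_prop

/-- The Gaussian measure of the coefficient vectors whose polynomial has a small product of values
over the grid of points `ρ (ω ^ a₁, …, ω ^ a_m)`. -/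
theorem pi_prod_grid_le {m N M q : ℕ} {ρ θ T L : ℝ} (hm : 1 ≤ m) (hq : 4 * m ≤ q)
    (hqρ : 12 ≤ q * ρ ^ 2) (hρ : 0 ≤ ρ) (hM : 0 < M) (hqM : q * M ≤ N) (hθ : 0 < θ) (hθ2 : θ < 2)
    (hT : 0 < T) (hL : 1 ≤ L) {ω : ℂ} (hω : IsPrimitiveRoot ω M) :
    Measure.pi (fun _ => stdComplexGaussian)
      {u : multiIdx m N → ℂ | (∀ j, ‖u j‖ ≤ T) ∧
        (∀ a : Fin m → Fin M, suPoly u (WithLp.toLp 2 fun i => ρ * ω ^ (a i : ℕ)) ≠ 0) ∧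
        ∏ a : Fin m → Fin M, ‖suPoly u (WithLp.toLp 2 fun i => ρ * ω ^ (a i : ℕ))‖ ≤
          L ^ (M ^ m)} ≤
      ENNReal.ofReal ((Real.exp (-M) * L ^ 2 *
        (2 * Real.pi * (2 * (T * Real.exp ((2 * m + ρ) * N))) ^ θ / θ)) ^ (M ^ m)) := by
  classical
  set z : (Fin m → Fin M) → EuclideanSpace ℂ (Fin m) :=
    fun a => WithLp.toLp 2 fun i => (ρ : ℂ) * ω ^ (a i : ℕ) with hz
  have hωn : ‖ω‖ = 1 := hω.norm'_eq_one hM.ne'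
  have hzn : ∀ a k, ‖z a k‖ ≤ ρ := fun a k => by
    simp [hz, hωn, abs_of_nonneg hρ]
  -- The factor `2` turns the bound on the grid values into a strict one.
  set R : ℝ := 2 * (T * Real.exp ((2 * m + ρ) * N)) with hR
  have hR0 : 0 < T * Real.exp ((2 * m + ρ) * N) := by positivity
  have hmem : ∀ k : Fin m → Fin M, (fun i => M + (k i : ℕ)) ∈ multiIdx m N := fun k => by
    rw [mem_multiIdx]
    calc ∑ i, (M + (k i : ℕ)) ≤ ∑ _i : Fin m, 2 * M :=
          Finset.sum_le_sum fun i _ => by have := (k i).2; omega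
      _ = 2 * m * M := by simp; ring
      _ ≤ N := by nlinarith
  -- Box indices represent each residue class mod `M` exactly once, making the characters distinct,
  -- while being at least `M`, making the weights large.
  set e : (Fin m → Fin M) → multiIdx m N := fun k => ⟨fun i => M + (k i : ℕ), hmem k⟩ with he
  have hinj : Function.Injective e := fun k k' h => by
    funext i
    have := congrFun (congrArg Subtype.val h) i
    simp only [he] at this
    exact Fin.ext (by omega)
  set c : multiIdx m N → EuclideanSpace ℂ (Fin m) → ℂ := fun j z =>
    ((Real.sqrt (multinomialCoeff N j.1) : ℝ) : ℂ) * ∏ k, z k ^ j.1 k with hc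
  set s : (Fin m → Fin M) → ℂ := fun k =>
    ((Real.sqrt (multinomialCoeff N (e k).1) : ℝ) : ℂ) * ρ ^ ∑ i, (e k).1 i with hs
  set F : Matrix (Fin m → Fin M) (Fin m → Fin M) ℂ :=
    Matrix.of fun a k => ∏ i, (ω ^ (a i : ℕ)) ^ (M + (k i : ℕ)) with hF
  set B : Matrix (Fin m → Fin M) (Fin m → Fin M) ℂ := F * Matrix.diagonal s with hB
  have hBc : ∀ a k, B a k = c (e k) (z a) := fun a k => by
    rw [hB, Matrix.mul_diagonal]
    simp only [hF, hs, hc, hz, he, Matrix.of_apply, mul_pow, Finset.prod_mul_distrib,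
      Finset.prod_pow_eq_pow_sum]
    ring
  have hsn : ∀ k, Real.exp M ≤ ‖s k‖ ^ 2 := fun k => by
    have h := exp_le_multinomialCoeff_mul hm hq hqρ hM hqM (j := (e k).1)
      (fun i => Nat.le_add_right _ _) (fun i => by have := (k i).2; simp only [he]; omega)
    rw [hs, norm_mul, Complex.norm_real, norm_pow, Complex.norm_real, Real.norm_of_nonneg hρ,
      Real.norm_of_nonneg (Real.sqrt_nonneg _), mul_pow, Real.sq_sqrt (multinomialCoeff_nonneg _ _)]
    exact h
  have hdet : Real.exp M ^ (M ^ m) ≤ ‖B.det‖ ^ 2 := by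
    rw [hB, Matrix.det_mul, Matrix.det_diagonal, norm_mul, norm_prod, mul_pow, ← Finset.prod_pow]
    have h1 : 1 ≤ ‖F.det‖ ^ 2 := one_le_pow₀ (one_le_norm_det_character hM hω M)
    have h2 : Real.exp M ^ (M ^ m) ≤ ∏ k, ‖s k‖ ^ 2 := by
      calc _ = ∏ _k : Fin m → Fin M, Real.exp M := by simp
        _ ≤ _ := Finset.prod_le_prod (fun _ _ => by positivity) fun k _ => hsn k
    have h3 : 0 ≤ Real.exp M ^ (M ^ m) := by positivity
    nlinarith
  have hmeas : MeasurableSet {u : multiIdx m N → ℂ | (∀ j, ‖u j‖ ≤ T) ∧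
      (∀ a, suPoly u (z a) ≠ 0) ∧ ∏ a, ‖suPoly u (z a)‖ ≤ L ^ (M ^ m)} := by
    have hco : ∀ a, Continuous fun u : multiIdx m N → ℂ => suPoly u (z a) :=
      fun a => continuous_suPoly (z a)
    have hset : {u : multiIdx m N → ℂ | (∀ j, ‖u j‖ ≤ T) ∧
        (∀ a, suPoly u (z a) ≠ 0) ∧ ∏ a, ‖suPoly u (z a)‖ ≤ L ^ (M ^ m)} =
        (⋂ j, {u | ‖u j‖ ≤ T}) ∩ ((⋂ a, {u | suPoly u (z a) ≠ 0}) ∩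
          {u | ∏ a, ‖suPoly u (z a)‖ ≤ L ^ (M ^ m)}) := by
      ext u
      simp
    rw [hset]
    refine MeasurableSet.inter ?_ (MeasurableSet.inter ?_ ?_)
    · exact MeasurableSet.iInter fun j =>
        (isClosed_le (by fun_prop) continuous_const).measurableSet
    · exact MeasurableSet.iInter fun a =>
        (isOpen_ne_fun (hco a) continuous_const).measurableSet
    · exact (isClosed_le (continuous_finsetProd _ fun a _ => (hco a).norm)
        continuous_const).measurableSet
  refine measure_pi_le_of_forall_slice stdComplexGaussian e hinj _ hmeas _ fun y => ?_
  set w : (Fin m → Fin M) → ℂ := fun a => ∑ j ∈ (Finset.univ.image e)ᶜ, y j * c j (z a) with hw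
  have hlin : ∀ u : multiIdx m N → ℂ, (∀ j ∉ Set.range e, u j = y j) → ∀ a,
      suPoly u (z a) = (w + B.mulVec fun k => u (e k)) a := fun u hu a => by
    rw [suPoly, ← Finset.sum_add_sum_compl (Finset.univ.image e), add_comm,
      Finset.sum_image fun _ _ _ _ h => hinj h]
    simp only [Pi.add_apply, hw, Matrix.mulVec, dotProduct, hBc, hc]
    congr 1
    · refine Finset.sum_congr rfl fun j hj => ?_
      rw [hu j (by simpa using hj)]
      ring
    · exact Finset.sum_congr rfl fun k _ => by ring
  refine (measure_mono ?_).trans ((gaussian_affine_prod_norm_le B w (Real.exp M ^ (M ^ m)) θ R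
    (L ^ (M ^ m)) (by positivity) hdet hθ hθ2 (by positivity) (by positivity)).trans ?_)
  · rintro x ⟨u, ⟨hu1, hu2, hu3⟩, hux, huy⟩
    have hx : (fun k => u (e k)) = x := funext hux
    have h := hlin u huy
    rw [hx] at h
    refine ⟨fun a => ⟨?_, ?_⟩, ?_⟩
    · rw [← h]
      exact hu2 a
    · rw [← h]
      have := norm_sum_monomial_le hρ hT.le Finset.univ u (fun j _ => hu1 j) (z a) (hzn a)
      rw [suPoly]
      linarith
    · simpa only [h] using hu3
  · refine ENNReal.ofReal_le_ofReal ?_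
    have hcard : Fintype.card (Fin m → Fin M) = M ^ m := by simp
    -- Since `L ≥ 1`, the exponent `2 - θ` may be raised to `2`.
    have hpow : (L ^ (M ^ m)) ^ (2 - θ) ≤ (L ^ 2) ^ (M ^ m) := by
      calc (L ^ (M ^ m)) ^ (2 - θ) ≤ (L ^ (M ^ m)) ^ (2 : ℝ) :=
            Real.rpow_le_rpow_of_exponent_le (one_le_pow₀ hL) (by linarith)
        _ = _ := by
            rw [Real.rpow_two]
            ring
    rw [hcard, mul_pow, mul_pow, Real.exp_neg, inv_pow, mul_assoc (_⁻¹)]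
    refine mul_le_mul_of_nonneg_left (mul_le_mul_of_nonneg_right hpow ?_) ?_ <;> positivity

theorem pi_exists_norm_gt_le {J : Type*} [Fintype J] (T : ℝ) (hT : 0 ≤ T) :
    Measure.pi (fun _ : J => stdComplexGaussian) {u | ∃ j, T < ‖u j‖} ≤
      ENNReal.ofReal (Fintype.card J * (2 * Real.exp (-T ^ 2 / 2))) := by
  have h1 : {u : J → ℂ | ∃ j, T < ‖u j‖} = ⋃ j, Function.eval j ⁻¹' {z | T < ‖z‖} := by
    ext u; simp
  rw [h1]
  refine (measure_iUnion_fintype_le _ _).trans ?_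
  have hms : MeasurableSet {z : ℂ | T < ‖z‖} := measurableSet_lt measurable_const measurable_norm
  calc _ ≤ ∑ _j : J, ENNReal.ofReal (2 * Real.exp (-T ^ 2 / 2)) := by
        refine Finset.sum_le_sum fun j _ => ?_
        rw [(measurePreserving_eval (fun _ : J => stdComplexGaussian) j).measure_preimage
          hms.nullMeasurableSet]
        exact stdComplexGaussian_norm_gt_le T hT
    _ = _ := by
        rw [Finset.sum_const, nsmul_eq_mul, ENNReal.ofReal_mul (Nat.cast_nonneg _),
          ENNReal.ofReal_natCast, Finset.card_univ]

/-- The closed polydisc of radius `ρ` lies in the ball because `√m ρ ≤ mρ < r`. The mean value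
constant is `4^q`, as `(4^q)^M = 2^{2qM} ≥ 2^N`. -/
theorem hole_subset_grid {m N M q : ℕ} {r ρ : ℝ} (hρ : 0 ≤ ρ) (hρr : m * ρ < r)
    (hM : 0 < M) (hNM : N ≤ 2 * q * M) (T : ℝ) {ω : ℂ} (hω : IsPrimitiveRoot ω M) :
    hole m N r ⊆ {u | ∃ j, T < ‖u j‖} ∪
      {u : multiIdx m N → ℂ | (∀ j, ‖u j‖ ≤ T) ∧
        (∀ a : Fin m → Fin M, suPoly u (WithLp.toLp 2 fun i => ρ * ω ^ (a i : ℕ)) ≠ 0) ∧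
        ∏ a : Fin m → Fin M, ‖suPoly u (WithLp.toLp 2 fun i => ρ * ω ^ (a i : ℕ))‖ ≤
          ((4 ^ q) ^ m * T) ^ (M ^ m)} := by
  intro u hu
  by_cases h : ∃ j, T < ‖u j‖
  · exact Or.inl h
  push Not at h
  have hne : ∀ z : Fin m → ℂ, (∀ i, ‖z i‖ ≤ ρ) → suPoly u (WithLp.toLp 2 z) ≠ 0 := by
    intro z hz
    refine hu _ (mem_ball_zero_iff.2 (lt_of_le_of_lt ?_ hρr))
    rw [EuclideanSpace.norm_eq, Real.sqrt_le_left (by positivity)]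
    calc ∑ i, ‖z i‖ ^ 2 ≤ ∑ _i : Fin m, ρ ^ 2 := by
          gcongr with i
          exact hz i
      _ = m * ρ ^ 2 := by simp
      _ ≤ (m * ρ) ^ 2 := by
          rw [mul_pow]
          gcongr
          exact_mod_cast Nat.le_self_pow two_ne_zero m
  refine Or.inr ⟨h, fun a => hne _ fun i => ?_, ?_⟩
  · simp [hω.norm'_eq_one hM.ne', abs_of_nonneg hρ]
  · refine (prod_norm_polydisc_le hM hω hρ (C := 4 ^ q) (by positivity) ?_ m
      (fun z => suPoly u (WithLp.toLp 2 z)) (fun i z => suPoly_update u i z) hne).trans ?_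
    · rw [← pow_mul, show (4 : ℝ) = 2 ^ 2 by norm_num, ← pow_mul, ← mul_assoc]
      exact pow_le_pow_right₀ (by norm_num) hNM
    · have h0 : suPoly u (WithLp.toLp 2 (0 : Fin m → ℂ)) = u ⟨0, zero_mem_multiIdx m N⟩ :=
        suPoly_zero u
      simp only [h0]
      gcongr
      exact h _

theorem exists_pi_hole_le (m : ℕ) (hm : 1 ≤ m) (r : ℝ) (hr : 0 < r) :
    ∃ c : ℝ, 0 < c ∧ ∃ N₀ : ℕ, ∀ N : ℕ, N₀ < N →
      Measure.pi (fun _ => stdComplexGaussian) (hole m N r) ≤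
        ENNReal.ofReal (Real.exp (-c * (N : ℝ) ^ (m + 1))) := by
  set ρ : ℝ := r / (m + 1) with hρ
  have hρ0 : 0 < ρ := by positivity
  have hρr : m * ρ < r := by
    have : (m + 1) * ρ = r := by
      rw [hρ]
      field_simp
    linarith
  obtain ⟨q₀, hq₀⟩ := exists_nat_ge (12 / ρ ^ 2)
  set q : ℕ := 4 * m + q₀ with hq
  have hq4 : 4 * m ≤ q := Nat.le_add_right _ _
  have hq1 : 0 < q := by omega
  have hqR : (0 : ℝ) < q := by exact_mod_cast hq1
  have hqρ : 12 ≤ q * ρ ^ 2 := by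
    rw [← div_le_iff₀ (by positivity)]
    refine hq₀.trans ?_
    exact_mod_cast Nat.le_add_left _ _
  -- Chosen so that `e^{(2m+ρ)Nθ} = e^{N/(8q)} ≤ e^{M/4}`, using `N ≤ 2qM`.
  set θ : ℝ := 1 / (8 * q * (2 * m + ρ)) with hθ
  have hθ0 : 0 < θ := by positivity
  have hmR : (1 : ℝ) ≤ m := by exact_mod_cast hm
  have hq1R : (1 : ℝ) ≤ q := by exact_mod_cast hq1
  have hθ1 : θ ≤ 1 := by
    rw [hθ, div_le_one (by positivity)]
    nlinarith
  set A : ℝ := ((4 ^ q) ^ m) ^ 2 * (2 * Real.pi * 2 / θ) with hA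
  have hA0 : 0 < A := by positivity
  -- The polynomial losses, `T² · T` with `T = N^{m+1}`, cost at most a second factor `e^{M/4}`,
  -- leaving `e^{-M/2}` per grid point.
  have hev : ∀ᶠ N : ℕ in Filter.atTop,
      A * (N : ℝ) ^ (3 * (m + 1)) ≤ Real.exp (1 / (8 * q) * N) := by
    have h1 := (isLittleO_pow_exp_pos_mul_atTop (k := 3 * (m + 1))
      (show (0 : ℝ) < 1 / (8 * q) by positivity)).comp_tendsto tendsto_natCast_atTop_atTop
    filter_upwards [h1.bound (show 0 < A⁻¹ by positivity)] with N hN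
    simp only [Function.comp_apply, norm_pow, Real.norm_eq_abs, Nat.abs_cast,
      Real.abs_exp] at hN
    rwa [inv_mul_eq_div, le_div_iff₀ hA0, mul_comm] at hN
  -- From `M ≥ N/(2q)`: `M^{m+1}/2 ≥ c N^{m+1}`.
  set c : ℝ := 1 / (2 * (2 * q) ^ (m + 1)) with hc
  have hc0 : 0 < c := by positivity
  have hc1 : c ≤ 1 := by
    rw [hc, div_le_one (by positivity)]
    have : (1 : ℝ) ≤ (2 * q) ^ (m + 1) := one_le_pow₀ (by linarith)
    linarith
  obtain ⟨N₁, hN₁⟩ := Filter.eventually_atTop.1 hev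
  obtain ⟨N₂, hN₂⟩ := exists_nat_ge (2 / c)
  -- Half of `c` absorbs the factor `2` from adding the tail event and the grid event.
  refine ⟨c / 2, by positivity, N₁ + N₂ + q + (4 * m + 8), fun N hN => ?_⟩
  have hNR : (4 * m + 8 : ℝ) ≤ N := by
    have : 4 * m + 8 ≤ N := by omega
    exact_mod_cast this
  have hN1R : (1 : ℝ) ≤ N := by linarith
  set M : ℕ := N / q with hMdef
  have hqM : q * M ≤ N := Nat.mul_div_le N q
  have hM : 0 < M := Nat.div_pos (by omega) hq1
  have hNM : N ≤ 2 * q * M := by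
    have h1 : N < q * (M + 1) := Nat.lt_mul_div_succ N hq1
    nlinarith
  have hNMR : (N : ℝ) ≤ 2 * q * M := by exact_mod_cast hNM
  obtain ⟨ω, hω⟩ : ∃ ω : ℂ, IsPrimitiveRoot ω M :=
    ⟨_, Complex.isPrimitiveRoot_exp M hM.ne'⟩
  set T : ℝ := (N : ℝ) ^ (m + 1) with hT
  have hNT : (N : ℝ) ≤ T := le_self_pow₀ hN1R (by omega)
  have hT1 : 1 ≤ T := hN1R.trans hNT
  have htail : Fintype.card (multiIdx m N) * (2 * Real.exp (-T ^ 2 / 2)) ≤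
      Real.exp (-(c * T)) := by
    rw [Fintype.card_coe]
    calc _ ≤ Real.exp (m * N) * (Real.exp 1 * Real.exp (-T ^ 2 / 2)) := by
          gcongr
          · exact card_multiIdx_le_exp m N
          · linarith [Real.add_one_le_exp 1]
      _ = Real.exp (m * N + (1 + -T ^ 2 / 2)) := by rw [Real.exp_add, Real.exp_add]
      _ ≤ _ := by
          rw [Real.exp_le_exp]
          have h1 : (4 * m + 8) * T ≤ T ^ 2 := by nlinarith
          have h2 : (m : ℝ) * N ≤ m * T := by gcongr
          have h3 : c * T ≤ 1 * T := by gcongr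
          nlinarith
  have hgrid : (Real.exp (-M) * ((4 ^ q) ^ m * T) ^ 2 *
      (2 * Real.pi * (2 * (T * Real.exp ((2 * m + ρ) * N))) ^ θ / θ)) ^ (M ^ m) ≤
      Real.exp (-(c * T)) := by
    have hpow : (2 * (T * Real.exp ((2 * m + ρ) * N))) ^ θ ≤ (2 * T) * Real.exp (M / 4) := by
      rw [← mul_assoc, Real.mul_rpow (by positivity) (by positivity), ← Real.exp_mul]
      gcongr
      · calc (2 * T) ^ θ ≤ (2 * T) ^ (1 : ℝ) :=
              Real.rpow_le_rpow_of_exponent_le (by linarith) hθ1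
          _ = 2 * T := Real.rpow_one _
      · have h1 : (2 * m + ρ) * N * θ = N / (8 * q) := by
          rw [hθ]
          field_simp
        rw [h1, div_le_iff₀ (by positivity)]
        linarith
    have hbase : Real.exp (-M) * ((4 ^ q) ^ m * T) ^ 2 *
        (2 * Real.pi * (2 * (T * Real.exp ((2 * m + ρ) * N))) ^ θ / θ) ≤
        Real.exp (-(M / 2 : ℝ)) := by
      calc _ ≤ Real.exp (-M) * ((4 ^ q) ^ m * T) ^ 2 *
            (2 * Real.pi * ((2 * T) * Real.exp (M / 4)) / θ) := by gcongr
        _ = Real.exp (-M) * Real.exp (M / 4) * (A * (N : ℝ) ^ (3 * (m + 1))) := by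
            rw [hA, mul_comm 3 (m + 1), pow_mul, ← hT]
            ring
        _ ≤ Real.exp (-M) * Real.exp (M / 4) * Real.exp (M / 4) := by
            gcongr
            refine (hN₁ N (by omega)).trans (Real.exp_le_exp.2 ?_)
            rw [one_div, inv_mul_eq_div, div_le_iff₀ (by positivity)]
            linarith
        _ = _ := by
            rw [← Real.exp_add, ← Real.exp_add]
            congr 1
            ring
    calc _ ≤ Real.exp (-(M / 2 : ℝ)) ^ (M ^ m) := by gcongr
      _ = Real.exp (-((M : ℝ) ^ (m + 1) / 2)) := by
          rw [← Real.exp_nat_mul]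
          congr 1
          push_cast
          ring
      _ ≤ _ := by
          rw [Real.exp_le_exp, neg_le_neg_iff]
          have h1 : T ≤ (2 * q) ^ (m + 1) * (M : ℝ) ^ (m + 1) := by
            rw [hT, ← mul_pow]
            gcongr
          rw [hc, one_div, inv_mul_eq_div, div_le_iff₀ (by positivity)]
          linarith
  have hcT : 1 ≤ c / 2 * T := by
    have h1 : (2 / c : ℝ) ≤ T := by
      refine hN₂.trans (le_trans ?_ hNT)
      exact_mod_cast (by omega : N₂ ≤ N)
    rw [div_le_iff₀ hc0] at h1
    linarith
  have hL : 1 ≤ ((4 : ℝ) ^ q) ^ m * T :=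
    one_le_mul_of_one_le_of_one_le (one_le_pow₀ (one_le_pow₀ (by norm_num))) hT1
  calc _ ≤ ENNReal.ofReal (Real.exp (-(c * T))) + ENNReal.ofReal (Real.exp (-(c * T))) := by
        refine (measure_mono (hole_subset_grid hρ0.le hρr hM hNM T hω)).trans
          ((measure_union_le _ _).trans (add_le_add ?_ ?_))
        · exact (pi_exists_norm_gt_le T (by linarith)).trans (ENNReal.ofReal_le_ofReal htail)
        · exact (pi_prod_grid_le hm hq4 hqρ hρ0.le hM hqM hθ0 (by linarith) (by linarith) hL
            hω).trans (ENNReal.ofReal_le_ofReal hgrid)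
    _ = ENNReal.ofReal (2 * Real.exp (-(c * T))) := by
        rw [← ENNReal.ofReal_add (by positivity) (by positivity), two_mul]
    _ ≤ _ := by
        refine ENNReal.ofReal_le_ofReal ?_
        calc _ ≤ Real.exp 1 * Real.exp (-(c * T)) := by
              gcongr
              linarith [Real.add_one_le_exp 1]
          _ ≤ _ := by
              rw [← Real.exp_add, Real.exp_le_exp]
              linarith

end

/-! ### Transfer to independent coefficients on a probability space. -/

theorem theorem2 (m : ℕ) (hm : 1 ≤ m) (r : ℝ) (hr : 0 < r) :
    ∃ c₁ : ℝ, 0 < c₁ ∧ ∃ c₂ : ℝ, 0 < c₂ ∧ ∃ N₀ : ℕ, ∀ N : ℕ, N₀ < N →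
      ∀ (Ω : Type*) [MeasurableSpace Ω] (P : Measure Ω) [IsProbabilityMeasure P]
        (α : multiIdx m N → Ω → ℂ),
        (∀ j, HasLaw (α j) stdComplexGaussian P) → iIndepFun α P →
          Real.exp (-c₂ * (N : ℝ) ^ (m + 1)) ≤ P.real {ω | (fun j => α j ω) ∈ hole m N r} ∧
          P.real {ω | (fun j => α j ω) ∈ hole m N r} ≤ Real.exp (-c₁ * (N : ℝ) ^ (m + 1)) := by
  obtain ⟨c₁, hc₁, N₀, h⟩ := exists_pi_hole_le m hm r hr
  refine ⟨c₁, hc₁, 2 ^ m * (9 + 2 * (2 * m + r + 1)), by positivity, N₀, ?_⟩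
  intro N hN Ω _ P _ α hlaw hind
  have hmeas : AEMeasurable (fun ω j => α j ω) P :=
    aemeasurable_pi_lambda _ fun j => (hlaw j).aemeasurable
  have hmap : P.map (fun ω j => α j ω) = Measure.pi fun _ => stdComplexGaussian := by
    rw [(iIndepFun_iff_map_fun_eq_pi_map fun j => (hlaw j).aemeasurable).1 hind]
    simp only [(hlaw _).map_eq]
  constructor
  -- Measurability of the hole event is avoided: a measurable subset serves here, and for the upper
  -- bound the image measure dominates the measure of the preimage of any set.
  · obtain ⟨S, hS, hsub, hle⟩ := le_pi_hole m N r hr (by omega)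
    rw [← hmap, Measure.map_apply_of_aemeasurable hmeas hS] at hle
    rw [Measure.real, ← ENNReal.ofReal_le_iff_le_toReal (measure_ne_top _ _)]
    exact hle.trans (measure_mono fun ω hω => hsub hω)
  · refine ENNReal.toReal_le_of_le_ofReal (Real.exp_pos _).le ?_
    refine le_trans ?_ (h N hN)
    rw [← hmap]
    exact Measure.le_map_apply hmeas _
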